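/- **Theorem 1.5.** Let $(\mathcal C,\otimes,I,C)$ be a braided monoidal category (written as if strict), and let $H$ be a Hopf algebra in $\mathcal C$ with multiplication $m$, unit $\eta$, comultiplication $\Delta$, counit $\epsilon$ and antipode $S$, such that $C_{H,H}=C_{H,H}^{-1}$. Write an object for its identity morphism. Let $H^d$ be a *faithful quasi-dual* of $H$, i.e. an algebra in $\mathcal C$ (multiplication $m$, unit $\eta$) with a morphism $\langle\,,\rangle:H^d\otimes H\to I$ such that $$\langle\,,\rangle(m\otimes H)=(\langle\,,\rangle\otimes\langle\,,\rangle)(H^d\otimes C_{H^d,H}\otimes H)(H^d\otimes H^d\otimes\Delta),\qquad \langle\,,\rangle(\eta\otimes H)=\epsilon,$$ and such that for all objects $U,V$ of $\mathcal C$: for $f,f':U\to V\otimes H^d$, $(V\otimes\langle\,,\rangle)(f\otimes H)=(V\otimes\langle\,,\rangle)(f'\otimes H)$ implies $f=f'$; and for $g,g':U\to H\otimes V$, $(\langle\,,\rangle\otimes V)(H^d\otimes g)=(\langle\,,\rangle\otimes V)(H^d\otimes g')$ implies $g=g'$. Let $H^{d'}$ be a *strict quasi-dual* of $H$, i.e.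 a left ideal of $H^d$ (a subobject $H^{d'}\hookrightarrow H^d$ such that the multiplication of $H^d$ restricts to $m:H^d\otimes H^{d'}\to H^{d'}$) together with morphisms $\rightharpoonup:H\otimes H^d\to H^d$ and $\rho:H^{d'}\to H^{d'}\otimes H$ such that $$\langle\,,\rangle(\rightharpoonup\otimes H)=\langle\,,\rangle(H^d\otimes m)(H^d\otimes C_{H,H})(C_{H,H^d}\otimes H),\qquad (H^{d'}\otimes\langle\,,\rangle)(C_{H^d,H^{d'}}\otimes H)(H^d\otimes\rho)=m,$$ and such that $\rightharpoonup$ restricts to a morphism $H\otimes H^{d'}\to H^{d'}$. Put $\leftharpoondown\;=\;\rightharpoonup(S\otimes H^{d'})\,C_{H^{d'},H}:H^{d'}\otimes H\to H^{d'}$. An *$H$-Hopf module* in $\mathcal C$ is an object $M$ that is a right $H$-module by $\alpha:M\otimes H\to M$ and a right $H$-comodule by $\phi:M\to M\otimes H$, such that $\phi\alpha=(\alpha\otimes m)(M\otimes C_{H,H}\otimes H)(\phi\otimes\Delta)$; morphisms of Hopf modules are the morphisms of $\mathcal C$ that are both $H$-linear and $H$-colinear. Let $(H^{d'})^{coH}$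 denote the equalizer of $\rho$ and $H^{d'}\otimes\eta: H^{d'}\to H^{d'}\otimes H$. Suppose that $\mathcal C$ has equalizers, or that the equalizer $(H^{d'})^{coH}$ exists in $\mathcal C$. Then $(H^{d'},\leftharpoondown,\rho)$ is an $H$-Hopf module and $$H^{d'}\cong (H^{d'})^{coH}\otimes H\quad\text{as $H$-Hopf modules in }\mathcal C,$$ where $(H^{d'})^{coH}\otimes H$ has action $(H^{d'})^{coH}\otimes m$ and coaction $(H^{d'})^{coH}\otimes\Delta$. -/

import Mathlib

open CategoryTheory MonoidalCategory CategoryTheory.Limits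
open scoped MonObj ComonObj HopfObj

universe v u

namespace BraidedHopf

section HopfModules

variable {C : Type u} [Category.{v} C] [MonoidalCategory C] [BraidedCategory C]

/-- `act : X ⊗ H ⟶ X` and `coact : X ⟶ X ⊗ H` make `X` a (right, right) `H`-Hopf module:
`X` is a right `H`-module, a right `H`-comodule, and
`coact ∘ act = (act ⊗ m) (X ⊗ C_{H,H} ⊗ H) (coact ⊗ Δ)`. -/
structure IsHopfModule (H : C) [HopfObj H] {X : C} (act : X ⊗ H ⟶ X) (coact : X ⟶ X ⊗ H) :
    Prop where
  act_one : X ◁ η[H] ≫ act = (ρ_ X).hom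
  act_mul : X ◁ μ[H] ≫ act = (α_ X H H).inv ≫ act ▷ H ≫ act
  coact_counit : coact ≫ X ◁ ε[H] = (ρ_ X).inv
  coact_comul : coact ≫ X ◁ Δ[H] = coact ≫ coact ▷ H ≫ (α_ X H H).hom
  act_coact : act ≫ coact = (coact ⊗ₘ Δ[H]) ≫ tensorμ X H H H ≫ (act ⊗ₘ μ[H])

/-- An `H`-Hopf module in `C`. -/
structure HopfModule (H : C) [HopfObj H] where
  X : C
  act : X ⊗ H ⟶ X
  coact : X ⟶ X ⊗ H
  isHopfModule : IsHopfModule H act coact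

namespace HopfModule

variable {H : C} [HopfObj H]

/-- A morphism of Hopf modules: a morphism that is both `H`-linear and `H`-colinear. -/
@[ext]
structure Hom (M N : HopfModule H) where
  hom : M.X ⟶ N.X
  act_hom : M.act ≫ hom = hom ▷ H ≫ N.act
  hom_coact : hom ≫ N.coact = M.coact ≫ hom ▷ H

instance : Category (HopfModule H) where
  Hom M N := Hom M N
  id M := ⟨𝟙 M.X, by simp, by simp⟩
  comp f g := ⟨f.hom ≫ g.hom,
    by rw [← Category.assoc, f.act_hom, Category.assoc, g.act_hom, comp_whiskerRight,
      Category.assoc],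
    by rw [Category.assoc, g.hom_coact, ← Category.assoc, f.hom_coact, comp_whiskerRight,
      Category.assoc]⟩
  id_comp f := Hom.ext (Category.id_comp f.hom)
  comp_id f := Hom.ext (Category.comp_id f.hom)
  assoc f g h := Hom.ext (Category.assoc f.hom g.hom h.hom)

variable (H) in
/-- For an object `V`, the Hopf module `V ⊗ H`, with action `V ⊗ m` and coaction `V ⊗ Δ`. -/
def free (V : C) : HopfModule H where
  X := V ⊗ H
  act := (α_ V H H).hom ≫ V ◁ μ[H]
  coact := V ◁ Δ[H] ≫ (α_ V H H).inv
  isHopfModule :=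
    { act_one := by
        have h : V ◁ (H ◁ η[H] ≫ μ[H]) = V ◁ (ρ_ H).hom := by rw [MonObj.mul_one]
        rw [MonoidalCategory.whiskerLeft_comp] at h
        simp [h]
      act_mul := by
        have h := congrArg (fun f => V ◁ f) (MonObj.mul_assoc_flip H)
        simp only [MonoidalCategory.whiskerLeft_comp] at h
        simp [h]
      coact_counit := by
        have h : V ◁ (Δ[H] ≫ H ◁ ε[H]) = V ◁ (ρ_ H).inv := by rw [ComonObj.comul_counit]
        rw [MonoidalCategory.whiskerLeft_comp] at h
        simp [reassoc_of% h]
      coact_comul := by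
        have h := congrArg (fun f => V ◁ f) (ComonObj.comul_assoc H)
        simp only [MonoidalCategory.whiskerLeft_comp] at h
        simp [reassoc_of% h]
      act_coact := by
        have h := congrArg (fun f => V ◁ f) (BimonObj.mul_comul H)
        simp only [MonoidalCategory.whiskerLeft_comp] at h
        simp only [Category.assoc, reassoc_of% h]
        simp only [tensorμ, MonoidalCategory.tensorHom_def]
        simp
        monoidal }

end HopfModule

/-- The coinvariants of a coaction `coact : X ⟶ X ⊗ H` exist as an object of `C`. -/
abbrev HasCoinvariants {H : C} [HopfObj H] {X : C} (coact : X ⟶ X ⊗ H) : Prop :=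
  HasEqualizer coact ((ρ_ X).inv ≫ X ◁ η[H])

/-- The coinvariants: the equalizer of `coact` and `X ⊗ η`. -/
noncomputable abbrev coinvariants {H : C} [HopfObj H] {X : C} (coact : X ⟶ X ⊗ H)
    [HasCoinvariants coact] : C :=
  equalizer coact ((ρ_ X).inv ≫ X ◁ η[H])

end HopfModules

section QuasiDuals

variable {C : Type u} [Category.{v} C] [MonoidalCategory C] [BraidedCategory C]

/-- The algebra `N` is a left quasi-dual of `H` under the pairing `ev : N ⊗ H ⟶ I`. -/
structure IsQuasiDual {H N : C} [HopfObj H] [MonObj N] (ev : N ⊗ H ⟶ 𝟙_ C) : Prop where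
  mul_ev : μ[N] ▷ H ≫ ev =
    (N ⊗ N) ◁ Δ[H] ≫ tensorμ N N H H ≫ (ev ⊗ₘ ev) ≫ (λ_ (𝟙_ C)).hom
  one_ev : η[N] ▷ H ≫ ev = (λ_ H).hom ≫ ε[H]

/-- The algebra `N` is a faithful quasi-dual of `H` under the pairing `ev`. -/
structure IsFaithfulQuasiDual {H N : C} [HopfObj H] [MonObj N] (ev : N ⊗ H ⟶ 𝟙_ C) : Prop
    extends IsQuasiDual ev where
  faithful_left : ∀ (U V : C) (f f' : U ⟶ V ⊗ N),
    f ▷ H ≫ (α_ V N H).hom ≫ V ◁ ev = f' ▷ H ≫ (α_ V N H).hom ≫ V ◁ ev → f = f'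
  faithful_right : ∀ (U V : C) (g g' : U ⟶ H ⊗ V),
    N ◁ g ≫ (α_ N H V).inv ≫ ev ▷ V = N ◁ g' ≫ (α_ N H V).inv ≫ ev ▷ V → g = g'

/-- A left ideal of the algebra `N`: a subobject `incl : X ⟶ N` such that the multiplication of `N`
restricts to a morphism `N ⊗ X ⟶ X`. -/
structure LeftIdeal (N : C) [MonObj N] where
  X : C
  incl : X ⟶ N
  mono_incl : Mono incl
  mul : N ⊗ X ⟶ X
  mul_incl : mul ≫ incl = N ◁ incl ≫ μ[N]

/-- A strict quasi-dual `L.X` of `H`, where the algebra `N` pairs with `H` by `ev` (to be used for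
a faithful quasi-dual `N`): a left ideal `L` of `N`, a morphism `harp : H ⊗ N ⟶ N` with
`⟨h ⇀ f, x⟩ = ⟨f, x h⟩`, whose restriction to `H ⊗ L` takes values in `L`, and a morphism
`coact : L ⟶ L ⊗ H` with `n f = f₀ ⟨n, f₁⟩` for `n` in `N` and `f` in `L`. -/
structure StrictQuasiDual {H N : C} [HopfObj H] [MonObj N] (ev : N ⊗ H ⟶ 𝟙_ C) where
  L : LeftIdeal N
  harp : H ⊗ N ⟶ N
  coact : L.X ⟶ L.X ⊗ H
  harp_ev : harp ▷ H ≫ ev =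
    (β_ H N).hom ▷ H ≫ (α_ N H H).hom ≫ N ◁ (β_ H H).hom ≫ N ◁ μ[H] ≫ ev
  coact_ev : N ◁ coact ≫ (α_ N L.X H).inv ≫ (β_ N L.X).hom ▷ H ≫ (α_ L.X N H).hom ≫
    L.X ◁ ev ≫ (ρ_ L.X).hom = L.mul
  harpL : H ⊗ L.X ⟶ L.X
  harpL_incl : harpL ≫ L.incl = H ◁ L.incl ≫ harp

/-- The right action `↼ = ⇀ (S ⊗ L) C_{L,H}` of `H` on the strict quasi-dual `L`. -/
def StrictQuasiDual.act {H N : C} [HopfObj H] [MonObj N] {ev : N ⊗ H ⟶ 𝟙_ C}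
    (D : StrictQuasiDual ev) : D.L.X ⊗ H ⟶ D.L.X :=
  (β_ D.L.X H).hom ≫ 𝒮[H] ▷ D.L.X ≫ D.harpL

end QuasiDuals

end BraidedHopf

/-! Two facts combine. A Hopf module whose coinvariants exist is free on them: `x ↦ x₀ S(x₁)` takes
values in the coinvariants, and `e ⊗ h ↦ e h` and `x ↦ x₀ S(x₁) ⊗ x₂` are mutually inverse
(`IsHopfModule.nonempty_iso_free`). And the strict quasi-dual `L` is a Hopf module
(`StrictQuasiDual.isHopfModule`), which is where duality enters.

For the second fact, faithfulness allows morphisms into `N ⊗ V` to be tested against `H`, and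
morphisms into `H ⊗ V` against `N`. Testing also carries `C_{H,H}² = 1` over to the double braidings
of `H` with `N` and with `L`, so the crossings met in the calculation can be undone. Under the
pairing, `⇀` becomes multiplication in `H` and the product of `N` becomes `Δ`; hence `⇀` is an
action with `h ⇀ (m n) = (h₁ ⇀ m)(h₂ ⇀ n)`. The coaction becomes left multiplication of `N` on `L`,
so the comodule axioms for `L` are its `N`-module axioms in disguise. The Hopf compatibility follows
from `n (S(h) ⇀ f) = S(h₁) ⇀ ((h₂ ⇀ n) f)` together with `(h₂ ⇀ n) f = ⟨n, f₁ h₂⟩ f₀`. -/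

namespace BraidedHopf

/-! ### String calculus: morphisms acting at the head of a right-nested tensor product with an inert
tail `Z`. -/

section Front

variable {C : Type u} [Category.{v} C] [MonoidalCategory C]

/-- Apply `f : X ⊗ Y ⟶ W` to the first two factors of a right-nested tensor product. -/
def front₂₁ {X Y W : C} (f : X ⊗ Y ⟶ W) (Z : C) : X ⊗ Y ⊗ Z ⟶ W ⊗ Z :=
  (α_ X Y Z).inv ≫ f ▷ Z

/-- Apply `f : X ⟶ Y ⊗ W` to the first factor of a right-nested tensor product. -/
def front₁₂ {X Y W : C} (f : X ⟶ Y ⊗ W) (Z : C) : X ⊗ Z ⟶ Y ⊗ W ⊗ Z :=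
  f ▷ Z ≫ (α_ Y W Z).hom

/-- Apply `f : X ⊗ Y ⟶ 𝟙_ C` to the first two factors of a right-nested tensor product. -/
def front₂₀ {X Y : C} (f : X ⊗ Y ⟶ 𝟙_ C) (Z : C) : X ⊗ Y ⊗ Z ⟶ Z :=
  (α_ X Y Z).inv ≫ f ▷ Z ≫ (λ_ Z).hom

/-- Apply `f : X ⟶ 𝟙_ C` to the first factor of a tensor product. -/
def front₁₀ {X : C} (f : X ⟶ 𝟙_ C) (Z : C) : X ⊗ Z ⟶ Z :=
  f ▷ Z ≫ (λ_ Z).hom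

/-- Insert `f : 𝟙_ C ⟶ X` as a new first factor. -/
def front₀₁ {X : C} (f : 𝟙_ C ⟶ X) (Z : C) : Z ⟶ X ⊗ Z :=
  (λ_ Z).inv ≫ f ▷ Z

lemma front₂₁_naturality {X Y W : C} (f : X ⊗ Y ⟶ W) {Z Z' : C} (g : Z ⟶ Z') :
    X ◁ Y ◁ g ≫ front₂₁ f Z' = front₂₁ f Z ≫ W ◁ g := by
  simp [front₂₁, ← whisker_exchange]

lemma front₁₂_naturality {X Y W : C} (f : X ⟶ Y ⊗ W) {Z Z' : C} (g : Z ⟶ Z') :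
    X ◁ g ≫ front₁₂ f Z' = front₁₂ f Z ≫ Y ◁ W ◁ g := by
  simp [front₁₂, whisker_exchange_assoc]

lemma front₂₀_naturality {X Y : C} (f : X ⊗ Y ⟶ 𝟙_ C) {Z Z' : C} (g : Z ⟶ Z') :
    X ◁ Y ◁ g ≫ front₂₀ f Z' = front₂₀ f Z ≫ g := by
  rw [front₂₀, associator_inv_naturality_right_assoc, whisker_exchange_assoc]
  simp [front₂₀]

lemma front₀₁_naturality {X : C} (f : 𝟙_ C ⟶ X) {Z Z' : C} (g : Z ⟶ Z') :
    g ≫ front₀₁ f Z' = front₀₁ f Z ≫ X ◁ g := by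
  simp [front₀₁, ← whisker_exchange]

/-- Identities are computed next to an arbitrary tail `Z`, so that they can be applied at any depth;
taking `Z` to be the unit recovers the bare identity. -/
lemma eq_of_whiskerRight_unit {X Y : C} {f g : X ⟶ Y} (h : f ▷ 𝟙_ C = g ▷ 𝟙_ C) : f = g := by
  simpa using h

lemma eq_of_front₁₂_unit {X Y W : C} {f g : X ⟶ Y ⊗ W}
    (h : front₁₂ f (𝟙_ C) = front₁₂ g (𝟙_ C)) : f = g :=
  eq_of_whiskerRight_unit ((cancel_mono (α_ _ _ _).hom).1 h)

variable [BraidedCategory C]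

/-- Braid the first two factors of a right-nested tensor product. -/
def swap (X Y Z : C) : X ⊗ Y ⊗ Z ⟶ Y ⊗ X ⊗ Z :=
  (α_ X Y Z).inv ≫ (β_ X Y).hom ▷ Z ≫ (α_ Y X Z).hom

instance (X Y Z : C) : IsIso (swap X Y Z) := by unfold swap; infer_instance

lemma swap_naturality (X Y : C) {Z Z' : C} (g : Z ⟶ Z') :
    X ◁ Y ◁ g ≫ swap X Y Z' = swap X Y Z ≫ Y ◁ X ◁ g := by
  rw [swap, associator_inv_naturality_right_assoc, whisker_exchange_assoc]
  simp [swap]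

lemma swap_naturality_left {X X' : C} (f : X ⟶ X') (Y Z : C) :
    f ▷ (Y ⊗ Z) ≫ swap X' Y Z = swap X Y Z ≫ Y ◁ f ▷ Z := by
  simp only [swap, Category.assoc, associator_inv_naturality_left_assoc,
    ← comp_whiskerRight_assoc, BraidedCategory.braiding_naturality_left]
  simp

lemma swap_naturality_middle (X : C) {Y Y' : C} (f : Y ⟶ Y') (Z : C) :
    X ◁ f ▷ Z ≫ swap X Y' Z = swap X Y Z ≫ f ▷ (X ⊗ Z) := by
  simp only [swap, Category.assoc, associator_inv_naturality_middle_assoc,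
    ← comp_whiskerRight_assoc, BraidedCategory.braiding_naturality_right]
  simp

lemma swap_tensor_right (X A B Z : C) :
    X ◁ (α_ A B Z).hom ≫ swap X A (B ⊗ Z) ≫ A ◁ swap X B Z =
      swap X (A ⊗ B) Z ≫ (α_ A B (X ⊗ Z)).hom := by
  simp only [swap, BraidedCategory.braiding_tensor_right_hom]
  monoidal

lemma swap_tensor_left (A B Y Z : C) :
    (α_ A B (Y ⊗ Z)).hom ≫ A ◁ swap B Y Z ≫ swap A Y (B ⊗ Z) =
      swap (A ⊗ B) Y Z ≫ Y ◁ (α_ A B Z).hom := by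
  simp only [swap, BraidedCategory.braiding_tensor_left_hom]
  monoidal

lemma swap_unit_left (Y Z : C) :
    swap (𝟙_ C) Y Z ≫ Y ◁ (λ_ Z).hom = (λ_ (Y ⊗ Z)).hom := by
  simp only [swap, braiding_tensorUnit_left]
  monoidal

lemma swap_unit_right (X Z : C) :
    swap X (𝟙_ C) Z ≫ (λ_ (X ⊗ Z)).hom = X ◁ (λ_ Z).hom := by
  simp only [swap, braiding_tensorUnit_right]
  monoidal

/-- Naturality of the braiding combined with a hexagon: a vertex slides through a crossing strand,
which then crosses each of its legs. The variants below differ in the shape of the vertex and the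
side of the strand. -/
lemma front₂₁_swap_left {A B X : C} (f : A ⊗ B ⟶ X) (Y Z : C) :
    front₂₁ f (Y ⊗ Z) ≫ swap X Y Z = A ◁ swap B Y Z ≫ swap A Y (B ⊗ Z) ≫ Y ◁ front₂₁ f Z := by
  have h := swap_tensor_left A B Y Z
  rw [front₂₁, Category.assoc, swap_naturality_left, Iso.inv_comp_eq, reassoc_of% h, front₂₁]
  simp

lemma front₂₁_swap_right {A B Y : C} (X : C) (f : A ⊗ B ⟶ Y) (Z : C) :
    X ◁ front₂₁ f Z ≫ swap X Y Z = swap X A (B ⊗ Z) ≫ A ◁ swap X B Z ≫ front₂₁ f (X ⊗ Z) := by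
  have h := swap_tensor_right X A B Z
  rw [← cancel_epi (X ◁ (α_ A B Z).hom), reassoc_of% h, front₂₁, front₂₁]
  simp [swap_naturality_middle]

lemma front₁₂_swap_left {A B X : C} (f : X ⟶ A ⊗ B) (Y Z : C) :
    front₁₂ f (Y ⊗ Z) ≫ A ◁ swap B Y Z ≫ swap A Y (B ⊗ Z) = swap X Y Z ≫ Y ◁ front₁₂ f Z := by
  have h := swap_tensor_left A B Y Z
  rw [front₁₂, front₁₂, Category.assoc, h, reassoc_of% swap_naturality_left]
  simp

lemma front₁₂_swap_right {A B Y : C} (X : C) (f : Y ⟶ A ⊗ B) (Z : C) :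
    X ◁ front₁₂ f Z ≫ swap X A (B ⊗ Z) ≫ A ◁ swap X B Z = swap X Y Z ≫ front₁₂ f (X ⊗ Z) := by
  have h := swap_tensor_right X A B Z
  rw [front₁₂, front₁₂, MonoidalCategory.whiskerLeft_comp, Category.assoc, h,
    reassoc_of% swap_naturality_middle]

lemma front₂₀_swap_right {A B : C} (X : C) (f : A ⊗ B ⟶ 𝟙_ C) (Z : C) :
    swap X A (B ⊗ Z) ≫ A ◁ swap X B Z ≫ front₂₀ f (X ⊗ Z) = X ◁ front₂₀ f Z := by
  have h := swap_tensor_right X A B Z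
  rw [← cancel_epi (X ◁ (α_ A B Z).hom), reassoc_of% h, front₂₀, front₂₀]
  simp [← swap_unit_right, reassoc_of% swap_naturality_middle]

lemma front₂₀_swap_left {A B : C} (f : A ⊗ B ⟶ 𝟙_ C) (Y Z : C) :
    A ◁ swap B Y Z ≫ swap A Y (B ⊗ Z) ≫ Y ◁ front₂₀ f Z = front₂₀ f (Y ⊗ Z) := by
  have h := swap_tensor_left A B Y Z
  rw [← cancel_epi (α_ A B (Y ⊗ Z)).hom, reassoc_of% h, front₂₀, front₂₀, ← swap_unit_left]
  simp only [← MonoidalCategory.whiskerLeft_comp, Iso.hom_inv_id_assoc]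
  rw [reassoc_of% swap_naturality_left, MonoidalCategory.whiskerLeft_comp]

lemma front₁₀_swap_left {A : C} (f : A ⟶ 𝟙_ C) (Y Z : C) :
    swap A Y Z ≫ Y ◁ front₁₀ f Z = front₁₀ f (Y ⊗ Z) := by
  simp only [front₁₀, ← swap_unit_left, reassoc_of% swap_naturality_left,
    MonoidalCategory.whiskerLeft_comp]

lemma front₀₁_swap_right {A : C} (X : C) (f : 𝟙_ C ⟶ A) (Z : C) :
    X ◁ front₀₁ f Z ≫ swap X A Z = front₀₁ f (X ⊗ Z) := by
  have h := swap_unit_right X Z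
  rw [← Iso.eq_comp_inv] at h
  simp [front₀₁, swap_naturality_middle, h]

lemma front₀₁_swap_left {A : C} (f : 𝟙_ C ⟶ A) (Y Z : C) :
    front₀₁ f (Y ⊗ Z) ≫ swap A Y Z = Y ◁ front₀₁ f Z := by
  have h := swap_unit_left Y Z
  rw [← whiskerLeftIso_hom, ← Iso.eq_comp_inv] at h
  rw [front₀₁, Category.assoc, swap_naturality_left, h]
  simp [front₀₁]

lemma swap_comp_swap {X Y : C} (h : (β_ X Y).hom ≫ (β_ Y X).hom = 𝟙 _) (Z : C) :
    swap X Y Z ≫ swap Y X Z = 𝟙 _ := by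
  have h := congrArg (· ▷ Z) h
  simp only [comp_whiskerRight] at h
  simp [swap, reassoc_of% h]

/-- Braiding with the unit is trivial, so a scalar-valued vertex passes freely from the left of `Z`
to its right. This matches left-handed pairings with the right-handed axioms. -/
lemma front₂₀_eq_braiding {A B : C} (f : A ⊗ B ⟶ 𝟙_ C) (Z : C) :
    front₂₀ f Z = A ◁ (β_ B Z).hom ≫ (α_ A Z B).inv ≫ (β_ A Z).hom ▷ B ≫ (α_ Z A B).hom ≫
      Z ◁ f ≫ (ρ_ Z).hom := by
  have h := BraidedCategory.braiding_naturality_left f Z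
  rw [BraidedCategory.braiding_tensor_left_hom, braiding_tensorUnit_left] at h
  rw [front₂₀, ← cancel_mono (ρ_ Z).inv, ← cancel_epi (α_ A B Z).hom]
  simpa using h

/-- The Yang–Baxter equation. -/
lemma swap_swap_swap (A B X Z : C) :
    A ◁ swap B X Z ≫ swap A X (B ⊗ Z) ≫ X ◁ swap A B Z =
      swap A B (X ⊗ Z) ≫ B ◁ swap A X Z ≫ swap B X (A ⊗ Z) := by
  have h := front₁₂_swap_left ((β_ A B).hom) X Z
  have e : ∀ W, (α_ A B W).inv ≫ front₁₂ (β_ A B).hom W = swap A B W := fun W => by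
    simp [front₁₂, swap]
  rw [← e, ← e, Category.assoc, h, MonoidalCategory.whiskerLeft_comp, Iso.eq_inv_comp,
    reassoc_of% (swap_tensor_left A B X Z)]
  simp

end Front

/-! ### The algebra, coalgebra and Hopf axioms next to an inert tail. -/

section FrontHopf

variable {C : Type u} [Category.{v} C] [MonoidalCategory C]

lemma front_mul_assoc (N : C) [MonObj N] (Z : C) :
    front₂₁ μ[N] (N ⊗ Z) ≫ front₂₁ μ[N] Z = N ◁ front₂₁ μ[N] Z ≫ front₂₁ μ[N] Z := by
  have h := congrArg (· ▷ Z) (MonObj.mul_assoc N)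
  simp only [comp_whiskerRight] at h
  rw [← cancel_epi (α_ N N (N ⊗ Z)).hom, ← cancel_epi (α_ (N ⊗ N) N Z).hom]
  simp only [front₂₁, Category.assoc]
  refine Eq.trans ?_ (h.trans ?_) <;> monoidal

lemma front_one_mul (N : C) [MonObj N] (Z : C) :
    front₀₁ η[N] (N ⊗ Z) ≫ front₂₁ μ[N] Z = 𝟙 _ := by
  have h := congrArg (· ▷ Z) (MonObj.one_mul N)
  simp only [comp_whiskerRight] at h
  rw [← cancel_epi (λ_ (N ⊗ Z)).hom, ← cancel_epi (α_ (𝟙_ C) N Z).hom]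
  simp only [front₂₁, front₀₁, Category.assoc]
  refine Eq.trans ?_ (h.trans ?_) <;> monoidal

lemma front_mul_one (N : C) [MonObj N] (Z : C) :
    N ◁ front₀₁ η[N] Z ≫ front₂₁ μ[N] Z = 𝟙 _ := by
  have h := congrArg (· ▷ Z) (MonObj.mul_one N)
  simp only [comp_whiskerRight] at h
  simp only [front₂₁, front₀₁, Category.assoc, MonoidalCategory.whiskerLeft_comp]
  rw [associator_inv_naturality_middle_assoc, h]
  monoidal

lemma front_comul_assoc (H : C) [ComonObj H] (Z : C) :
    front₁₂ Δ[H] Z ≫ front₁₂ Δ[H] (H ⊗ Z) = front₁₂ Δ[H] Z ≫ H ◁ front₁₂ Δ[H] Z := by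
  have h := congrArg (· ▷ Z) (ComonObj.comul_assoc H)
  simp only [comp_whiskerRight] at h
  rw [← cancel_mono (α_ H H (H ⊗ Z)).inv, ← cancel_mono (α_ (H ⊗ H) H Z).inv,
    ← cancel_mono ((α_ H H H).hom ▷ Z)]
  simp only [front₁₂, Category.assoc]
  symm
  refine Eq.trans ?_ (h.trans ?_) <;> monoidal

lemma front_counit_comul (H : C) [ComonObj H] (Z : C) :
    front₁₂ Δ[H] Z ≫ front₁₀ ε[H] (H ⊗ Z) = 𝟙 _ := by
  have h := congrArg (· ▷ Z) (ComonObj.counit_comul H)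
  simp only [comp_whiskerRight] at h
  simp only [front₁₂, front₁₀, Category.assoc]
  rw [← associator_naturality_left_assoc, reassoc_of% h]
  monoidal

lemma front_comul_counit (H : C) [ComonObj H] (Z : C) :
    front₁₂ Δ[H] Z ≫ H ◁ front₁₀ ε[H] Z = 𝟙 _ := by
  have h := congrArg (· ▷ Z) (ComonObj.comul_counit H)
  simp only [comp_whiskerRight] at h
  simp only [front₁₂, front₁₀, Category.assoc, MonoidalCategory.whiskerLeft_comp]
  rw [← associator_naturality_middle_assoc, reassoc_of% h]
  monoidal

variable [BraidedCategory C]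

/-- The compatibility of an action with a coaction, next to an inert factor `Z`. -/
lemma front_act_coact {H X : C} [HopfObj H] {act : X ⊗ H ⟶ X} {coact : X ⟶ X ⊗ H}
    (h : act ≫ coact = (coact ⊗ₘ Δ[H]) ≫ tensorμ X H H H ≫ (act ⊗ₘ μ[H])) (Z : C) :
    front₂₁ act Z ≫ front₁₂ coact Z = front₁₂ coact (H ⊗ Z) ≫ X ◁ H ◁ front₁₂ Δ[H] Z ≫
      X ◁ swap H H (H ⊗ Z) ≫ front₂₁ act (H ⊗ H ⊗ Z) ≫ X ◁ front₂₁ μ[H] Z := by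
  have h := congrArg (· ▷ Z) h
  simp only [comp_whiskerRight] at h
  rw [← cancel_epi (α_ X H Z).hom, ← cancel_mono (α_ X H Z).inv]
  simp only [front₁₂, front₂₁, Category.assoc, Iso.hom_inv_id, Iso.hom_inv_id_assoc,
    Category.comp_id]
  rw [h]
  simp only [tensorμ, swap, MonoidalCategory.tensorHom_def]
  monoidal

lemma front_mul_comul (H : C) [HopfObj H] (Z : C) :
    front₂₁ μ[H] Z ≫ front₁₂ Δ[H] Z = front₁₂ Δ[H] (H ⊗ Z) ≫ H ◁ H ◁ front₁₂ Δ[H] Z ≫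
      H ◁ swap H H (H ⊗ Z) ≫ front₂₁ μ[H] (H ⊗ H ⊗ Z) ≫ H ◁ front₂₁ μ[H] Z :=
  front_act_coact (BimonObj.mul_comul H) Z

lemma front_antipode_comul (H : C) [HopfObj H] (Z : C) :
    𝒮[H] ▷ Z ≫ front₁₂ Δ[H] Z =
      front₁₂ Δ[H] Z ≫ swap H H Z ≫ 𝒮[H] ▷ (H ⊗ Z) ≫ H ◁ 𝒮[H] ▷ Z := by
  have h := congrArg (· ▷ Z) (HopfObj.antipode_comul H)
  simp only [comp_whiskerRight] at h
  rw [← cancel_mono (α_ H H Z).inv]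
  simp only [front₁₂, swap, Category.assoc, Iso.hom_inv_id, Iso.hom_inv_id_assoc, Category.comp_id]
  rw [h, MonoidalCategory.tensorHom_def]
  monoidal

lemma front_mul_antipode (H : C) [HopfObj H] (Z : C) :
    front₂₁ μ[H] Z ≫ 𝒮[H] ▷ Z =
      𝒮[H] ▷ (H ⊗ Z) ≫ H ◁ 𝒮[H] ▷ Z ≫ swap H H Z ≫ front₂₁ μ[H] Z := by
  have h := congrArg (· ▷ Z) (HopfObj.mul_antipode H)
  simp only [comp_whiskerRight] at h
  rw [← cancel_epi (α_ H H Z).hom]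
  simp only [front₂₁, swap, Category.assoc, Iso.hom_inv_id_assoc]
  rw [h, MonoidalCategory.tensorHom_def]
  monoidal

lemma front_antipode_left (H : C) [HopfObj H] (Z : C) :
    front₁₂ Δ[H] Z ≫ 𝒮[H] ▷ (H ⊗ Z) ≫ front₂₁ μ[H] Z = front₁₀ ε[H] Z ≫ front₀₁ η[H] Z := by
  have h := congrArg (· ▷ Z) (HopfObj.antipode_left H)
  simp only [comp_whiskerRight] at h
  simp only [front₁₂, front₂₁, front₁₀, front₀₁, Category.assoc, Iso.hom_inv_id_assoc, ← h]
  monoidal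

lemma front_antipode_right (H : C) [HopfObj H] (Z : C) :
    front₁₂ Δ[H] Z ≫ H ◁ 𝒮[H] ▷ Z ≫ front₂₁ μ[H] Z = front₁₀ ε[H] Z ≫ front₀₁ η[H] Z := by
  have h := congrArg (· ▷ Z) (HopfObj.antipode_right H)
  simp only [comp_whiskerRight] at h
  simp only [front₁₂, front₂₁, front₁₀, front₀₁, Category.assoc, Iso.hom_inv_id_assoc, ← h]
  monoidal

end FrontHopf

/-! ### The fundamental theorem of Hopf modules. -/

section FundamentalTheorem

variable {C : Type u} [Category.{v} C] [MonoidalCategory C] [BraidedCategory C]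
variable {H : C} [HopfObj H] {X : C} {act : X ⊗ H ⟶ X} {coact : X ⟶ X ⊗ H}

namespace IsHopfModule

lemma front_act_one (hX : IsHopfModule H act coact) (Z : C) :
    X ◁ front₀₁ η[H] Z ≫ front₂₁ act Z = 𝟙 _ := by
  have h := congrArg (· ▷ Z) hX.act_one
  simp only [comp_whiskerRight] at h
  simp only [front₂₁, front₀₁, Category.assoc, MonoidalCategory.whiskerLeft_comp]
  rw [associator_inv_naturality_middle_assoc, h]
  monoidal

lemma front_act_mul (hX : IsHopfModule H act coact) (Z : C) :
    X ◁ front₂₁ μ[H] Z ≫ front₂₁ act Z = front₂₁ act (H ⊗ Z) ≫ front₂₁ act Z := by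
  have h := congrArg (· ▷ Z) hX.act_mul
  simp only [comp_whiskerRight] at h
  simp only [front₂₁, Category.assoc, MonoidalCategory.whiskerLeft_comp]
  rw [associator_inv_naturality_middle_assoc, h]
  monoidal

lemma front_coact_counit (hX : IsHopfModule H act coact) (Z : C) :
    front₁₂ coact Z ≫ X ◁ front₁₀ ε[H] Z = 𝟙 _ := by
  have h := congrArg (· ▷ Z) hX.coact_counit
  simp only [comp_whiskerRight] at h
  simp only [front₁₂, front₁₀, Category.assoc, MonoidalCategory.whiskerLeft_comp]
  rw [← associator_naturality_middle_assoc, reassoc_of% h]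
  monoidal

lemma front_coact_comul (hX : IsHopfModule H act coact) (Z : C) :
    front₁₂ coact Z ≫ X ◁ front₁₂ Δ[H] Z = front₁₂ coact Z ≫ front₁₂ coact (H ⊗ Z) := by
  have h := congrArg (· ▷ Z) hX.coact_comul
  simp only [comp_whiskerRight] at h
  simp only [front₁₂, Category.assoc, MonoidalCategory.whiskerLeft_comp]
  rw [← associator_naturality_middle_assoc, reassoc_of% h]
  monoidal

end IsHopfModule

/-- The endomorphism `x ↦ x₀ S(x₁)` of a Hopf module. -/
def coinvariantsEndo (act : X ⊗ H ⟶ X) (coact : X ⟶ X ⊗ H) : X ⟶ X :=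
  coact ≫ X ◁ 𝒮[H] ≫ act

lemma coinvariantsEndo_whiskerRight (act : X ⊗ H ⟶ X) (coact : X ⟶ X ⊗ H) (Z : C) :
    coinvariantsEndo act coact ▷ Z = front₁₂ coact Z ≫ X ◁ 𝒮[H] ▷ Z ≫ front₂₁ act Z := by
  simp only [coinvariantsEndo, front₁₂, front₂₁]
  monoidal

/-- In Sweedler notation, `S(h₃) ⊗ h₁ S(h₂) = S(h) ⊗ 1`: the antipode reverses `Δ`, after which the
antipode axiom collapses the two adjacent factors. -/
lemma antipode_comul_mul (H Z : C) [HopfObj H] :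
    front₁₂ Δ[H] Z ≫ H ◁ 𝒮[H] ▷ Z ≫ H ◁ front₁₂ Δ[H] Z ≫ swap H H (H ⊗ Z) ≫
      H ◁ front₂₁ μ[H] Z = 𝒮[H] ▷ Z ≫ H ◁ front₀₁ η[H] Z := by
  have hf : ∀ W, front₂₁ (H ◁ 𝒮[H] ≫ μ[H]) W = H ◁ 𝒮[H] ▷ W ≫ front₂₁ μ[H] W := fun W => by
    simp [front₂₁]
  have h1 := congrArg (H ◁ ·) (front_antipode_comul H Z)
  simp only [MonoidalCategory.whiskerLeft_comp] at h1
  have h2 := front₂₁_swap_left (H ◁ 𝒮[H] ≫ μ[H]) H Z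
  simp only [hf, MonoidalCategory.whiskerLeft_comp, Category.assoc] at h2
  rw [reassoc_of% h1, reassoc_of% swap_naturality, reassoc_of% swap_naturality_middle,
    ← whisker_exchange_assoc, ← whisker_exchange, ← reassoc_of% h2,
    ← reassoc_of% front_comul_assoc, reassoc_of% front_antipode_right,
    reassoc_of% front_counit_comul,
    reassoc_of% front₀₁_swap_left, whisker_exchange]

/-- The coaction sends `x₀ S(x₁)` to `x₀ S(x₃) ⊗ x₁ S(x₂) = x₀ S(x₁) ⊗ 1`, so the endomorphism
factors through the coinvariants. -/
lemma IsHopfModule.coinvariantsEndo_coact (hX : IsHopfModule H act coact) :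
    coinvariantsEndo act coact ≫ coact =
      coinvariantsEndo act coact ≫ (ρ_ X).inv ≫ X ◁ η[H] := by
  apply eq_of_front₁₂_unit
  have e1 : ∀ g : X ⟶ X ⊗ H, front₁₂ (coinvariantsEndo act coact ≫ g) (𝟙_ C) =
      coinvariantsEndo act coact ▷ 𝟙_ C ≫ front₁₂ g (𝟙_ C) := fun g => by simp [front₁₂]
  have e2 : front₁₂ ((ρ_ X).inv ≫ X ◁ η[H]) (𝟙_ C) = X ◁ front₀₁ η[H] (𝟙_ C) := by
    simp only [front₁₂, front₀₁]
    monoidal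
  rw [e1, e1, e2, coinvariantsEndo_whiskerRight]
  have h := congrArg (X ◁ ·) (antipode_comul_mul H (𝟙_ C))
  simp only [MonoidalCategory.whiskerLeft_comp] at h
  simp only [Category.assoc]
  rw [front_act_coact hX.act_coact, ← front₂₁_naturality, ← front₂₁_naturality,
    reassoc_of% front₁₂_naturality, ← reassoc_of% hX.front_coact_comul, reassoc_of% h]

section Iso

variable {E : C} {i : E ⟶ X}

lemma front_coact_of_coinvariant (hi : i ≫ coact = i ≫ (ρ_ X).inv ≫ X ◁ η[H]) (Z : C) :
    i ▷ Z ≫ front₁₂ coact Z = i ▷ Z ≫ X ◁ front₀₁ η[H] Z := by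
  have h := congrArg (· ▷ Z) hi
  simp only [comp_whiskerRight] at h
  simp only [front₁₂, front₀₁]
  rw [reassoc_of% h]
  monoidal

lemma IsHopfModule.front_act_coact_of_coinvariant (hX : IsHopfModule H act coact)
    (hi : i ≫ coact = i ≫ (ρ_ X).inv ≫ X ◁ η[H]) (Z : C) :
    i ▷ (H ⊗ Z) ≫ front₂₁ act Z ≫ front₁₂ coact Z =
      i ▷ (H ⊗ Z) ≫ X ◁ front₁₂ Δ[H] Z ≫ front₂₁ act (H ⊗ Z) := by
  have h : front₀₁ η[H] (H ⊗ Z) ≫ H ◁ front₁₂ Δ[H] Z ≫ swap H H (H ⊗ Z) ≫ H ◁ front₂₁ μ[H] Z =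
      front₁₂ Δ[H] Z := by
    rw [← reassoc_of% front₀₁_naturality, reassoc_of% front₀₁_swap_left,
      ← MonoidalCategory.whiskerLeft_comp,
      front_one_mul]
    simp
  have h := congrArg (X ◁ ·) h
  simp only [MonoidalCategory.whiskerLeft_comp] at h
  rw [front_act_coact hX.act_coact, ← front₂₁_naturality,
    reassoc_of% front_coact_of_coinvariant hi, reassoc_of% h]

lemma IsHopfModule.act_coact_of_coinvariant (hX : IsHopfModule H act coact)
    (hi : i ≫ coact = i ≫ (ρ_ X).inv ≫ X ◁ η[H]) :
    i ▷ H ≫ act ≫ coact = E ◁ Δ[H] ≫ (α_ E H H).inv ≫ (i ▷ H ≫ act) ▷ H := by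
  apply eq_of_whiskerRight_unit
  have h := hX.front_act_coact_of_coinvariant hi (𝟙_ C)
  rw [← cancel_epi (α_ E H (𝟙_ C)).hom, ← cancel_mono (α_ X H (𝟙_ C)).inv] at h
  refine Eq.trans ?_ (h.trans ?_)
  · simp [front₁₂, front₂₁]
  · rw [← whisker_exchange_assoc]
    simp only [front₁₂, front₂₁]
    monoidal

/-- For coinvariant `e`, the coaction of `e h` is `e h₁ ⊗ h₂`, and `e h₁ S(h₂) = ε(h) e`. -/
lemma IsHopfModule.act_coinvariantsEndo (hX : IsHopfModule H act coact)
    (hi : i ≫ coact = i ≫ (ρ_ X).inv ≫ X ◁ η[H]) :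
    i ▷ H ≫ act ≫ coinvariantsEndo act coact = E ◁ ε[H] ≫ (ρ_ E).hom ≫ i := by
  apply eq_of_whiskerRight_unit
  have h := congrArg (X ◁ ·) (front_antipode_right H (𝟙_ C))
  simp only [MonoidalCategory.whiskerLeft_comp] at h
  rw [← cancel_epi (α_ E H (𝟙_ C)).inv]
  calc _ = i ▷ (H ⊗ 𝟙_ C) ≫ front₂₁ act (𝟙_ C) ≫ coinvariantsEndo act coact ▷ 𝟙_ C := by
        simp [front₂₁]
    _ = i ▷ (H ⊗ 𝟙_ C) ≫ X ◁ front₁₀ ε[H] (𝟙_ C) := by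
        rw [coinvariantsEndo_whiskerRight,
          reassoc_of% hX.front_act_coact_of_coinvariant hi, ← reassoc_of% front₂₁_naturality,
          ← hX.front_act_mul, reassoc_of% h, hX.front_act_one, Category.comp_id]
    _ = _ := by
        rw [← whisker_exchange]
        simp only [front₁₀]
        monoidal

/-- The calculation is `x₀ S(x₁) x₂ = x₀ ε(x₁) = x`. -/
lemma IsHopfModule.coact_coinvariantsEndo_act (hX : IsHopfModule H act coact) :
    coact ≫ coinvariantsEndo act coact ▷ H ≫ act = 𝟙 X := by
  apply eq_of_whiskerRight_unit
  have h := congrArg (X ◁ ·) (front_antipode_left H (𝟙_ C))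
  simp only [MonoidalCategory.whiskerLeft_comp] at h
  calc _ = front₁₂ coact (𝟙_ C) ≫ coinvariantsEndo act coact ▷ (H ⊗ 𝟙_ C) ≫
        front₂₁ act (𝟙_ C) := by
        simp [front₂₁, front₁₂]
    _ = 𝟙 _ := by
        rw [coinvariantsEndo_whiskerRight, Category.assoc, Category.assoc, ← hX.front_act_mul,
          ← reassoc_of% hX.front_coact_comul, reassoc_of% h, hX.front_act_one, Category.comp_id,
          hX.front_coact_counit]
    _ = _ := by simp

end Iso

/-- An isomorphism that is linear and colinear is an isomorphism of Hopf modules. -/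
def HopfModule.isoMk {M N : HopfModule H} (e : M.X ≅ N.X)
    (act_hom : M.act ≫ e.hom = e.hom ▷ H ≫ N.act)
    (hom_coact : e.hom ≫ N.coact = M.coact ≫ e.hom ▷ H) : M ≅ N where
  hom := ⟨e.hom, act_hom, hom_coact⟩
  inv := ⟨e.inv,
    by rw [← cancel_mono e.hom, Category.assoc, Category.assoc, act_hom]; simp,
    by rw [← cancel_epi e.hom, reassoc_of% hom_coact]; simp⟩
  hom_inv_id := HopfModule.Hom.ext e.hom_inv_id
  inv_hom_id := HopfModule.Hom.ext e.inv_hom_id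

/-- The fundamental theorem of Hopf modules: a Hopf module whose coinvariants exist is free on
them. -/
theorem IsHopfModule.nonempty_iso_free (hX : IsHopfModule H act coact) [HasCoinvariants coact] :
    Nonempty ((⟨X, act, coact, hX⟩ : HopfModule H) ≅
      HopfModule.free H (coinvariants coact)) := by
  let i : coinvariants coact ⟶ X := equalizer.ι _ _
  have hi : i ≫ coact = i ≫ (ρ_ X).inv ≫ X ◁ η[H] := equalizer.condition _ _
  let p : X ⟶ coinvariants coact :=
    equalizer.lift (coinvariantsEndo act coact) hX.coinvariantsEndo_coact
  have hp : p ≫ i = coinvariantsEndo act coact := equalizer.lift_ι _ _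
  have hip : i ▷ H ≫ act ≫ p = coinvariants coact ◁ ε[H] ≫ (ρ_ _).hom := by
    rw [← cancel_mono i]
    simp [hp, hX.act_coinvariantsEndo hi]
  have h₁ : (coact ≫ p ▷ H) ≫ i ▷ H ≫ act = 𝟙 X := by
    rw [Category.assoc, ← comp_whiskerRight_assoc, hp, hX.coact_coinvariantsEndo_act]
  have h₂ : (i ▷ H ≫ act) ≫ coact ≫ p ▷ H = 𝟙 _ := by
    have h := hX.act_coact_of_coinvariant hi
    simp only [Category.assoc]
    rw [reassoc_of% h, ← comp_whiskerRight, Category.assoc, hip, comp_whiskerRight,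
      ← associator_inv_naturality_middle_assoc, ← MonoidalCategory.whiskerLeft_comp_assoc,
      ComonObj.counit_comul]
    simp
  -- Linearity and colinearity are checked for `e ⊗ h ↦ e h`, where they are direct; the inverse
  -- inherits them.
  refine ⟨(HopfModule.isoMk (M := HopfModule.free H (coinvariants coact))
    (N := ⟨X, act, coact, hX⟩) ⟨i ▷ H ≫ act, coact ≫ p ▷ H, h₂, h₁⟩ ?_ ?_).symm⟩
  · simp only [HopfModule.free, Category.assoc, comp_whiskerRight]
    rw [whisker_exchange_assoc, hX.act_mul]
    simp
  · simp only [HopfModule.free, Category.assoc]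
    exact hX.act_coact_of_coinvariant hi

end FundamentalTheorem

/-! ### Consequences of faithfulness: trivial double braidings and the algebra of `⇀`. -/

section Pairing

variable {C : Type u} [Category.{v} C] [MonoidalCategory C] [BraidedCategory C]

variable {H N : C}

/-- Pair the first two factors of a tensor product, where the factor `N` comes second. -/
def pairing (ev : N ⊗ H ⟶ 𝟙_ C) (Z : C) : H ⊗ N ⊗ Z ⟶ Z :=
  swap H N Z ≫ front₂₀ ev Z

lemma pairing_naturality (ev : N ⊗ H ⟶ 𝟙_ C) {Z Z' : C} (g : Z ⟶ Z') :
    H ◁ N ◁ g ≫ pairing ev Z' = pairing ev Z ≫ g := by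
  simp only [pairing, reassoc_of% swap_naturality, front₂₀_naturality, Category.assoc]

lemma braiding_pairing (ev : N ⊗ H ⟶ 𝟙_ C) (Z : C) :
    (β_ H (N ⊗ Z)).hom ≫ (β_ N Z).hom ▷ H ≫ (α_ Z N H).hom ≫ Z ◁ ev ≫ (ρ_ Z).hom =
      pairing ev Z := by
  rw [pairing, front₂₀_eq_braiding, BraidedCategory.braiding_tensor_right_hom, swap]
  simp

variable [HopfObj H] [MonObj N] {ev : N ⊗ H ⟶ 𝟙_ C}

lemma IsFaithfulQuasiDual.hom_ext_right (hev : IsFaithfulQuasiDual ev) {U V : C}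
    {g g' : U ⟶ H ⊗ V} (h : N ◁ g ≫ front₂₀ ev V = N ◁ g' ≫ front₂₀ ev V) : g = g' := by
  apply hev.faithful_right
  rw [← cancel_mono (λ_ V).hom]
  simpa [front₂₀] using h

/-- The pairing slides across an `H`-strand with no crossing left over, so once `N` is paired with
`H`, a double crossing of the strand with `N` can be traded for one with the paired `H`. That one is
trivial by `hH`, and faithfulness removes the pairing. -/
lemma IsFaithfulQuasiDual.braiding_braiding (hev : IsFaithfulQuasiDual ev)
    (hH : (β_ H H).hom = (β_ H H).inv) : (β_ H N).hom ≫ (β_ N H).hom = 𝟙 _ := by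
  have hHH : (β_ H H).hom ≫ (β_ H H).hom = 𝟙 _ := by nth_rw 2 [hH]; simp
  have h₁ := congrArg (N ◁ ·) (swap_comp_swap hHH (𝟙_ C))
  simp only [MonoidalCategory.whiskerLeft_comp] at h₁
  have h₂ := front₂₀_swap_left ev H (𝟙_ C)
  have h₃ : swap H N (H ⊗ 𝟙_ C) ≫ swap N H (H ⊗ 𝟙_ C) ≫ H ◁ front₂₀ ev (𝟙_ C) =
      H ◁ front₂₀ ev (𝟙_ C) := by
    nth_rw 2 [← front₂₀_swap_right]
    rw [← h₂, reassoc_of% h₁]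
    simp
  apply hev.faithful_left
  apply eq_of_whiskerRight_unit
  rw [← cancel_epi ((α_ (H ⊗ N) H (𝟙_ C)).inv), ← cancel_epi ((α_ H N (H ⊗ 𝟙_ C)).inv),
    ← cancel_mono ((α_ H (𝟙_ C) (𝟙_ C)).hom), ← cancel_mono (H ◁ (λ_ (𝟙_ C)).hom)]
  refine Eq.trans ?_ (h₃.trans ?_)
  · simp only [swap, front₂₀]
    monoidal
  · simp only [front₂₀]
    monoidal

/-- Faithfulness in the form used below, with the test factor `H` on the left; the braidings that
move it there are invertible. -/
lemma IsFaithfulQuasiDual.hom_ext_left (hev : IsFaithfulQuasiDual ev) {U Z : C}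
    {f f' : U ⟶ N ⊗ Z} (h : H ◁ f ≫ pairing ev Z = H ◁ f' ≫ pairing ev Z) : f = f' := by
  rw [← cancel_mono (β_ N Z).hom]
  apply hev.faithful_left
  rw [← cancel_epi (β_ H U).hom, ← cancel_mono (ρ_ Z).hom]
  simp only [← braiding_pairing, BraidedCategory.braiding_naturality_right_assoc] at h
  simpa using h

lemma IsQuasiDual.front_mul_ev (hev : IsQuasiDual ev) (Z : C) :
    front₂₁ μ[N] (H ⊗ Z) ≫ front₂₀ ev Z = N ◁ N ◁ front₁₂ Δ[H] Z ≫ N ◁ swap N H (H ⊗ Z) ≫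
      front₂₀ ev (N ⊗ H ⊗ Z) ≫ front₂₀ ev Z := by
  have h := congrArg (· ▷ Z) hev.mul_ev
  simp only [comp_whiskerRight] at h
  rw [← cancel_epi (α_ N N (H ⊗ Z)).hom, ← cancel_epi (α_ (N ⊗ N) H Z).hom,
    ← cancel_mono (λ_ Z).inv]
  refine Eq.trans ?_ (h.trans ?_)
  · simp only [front₂₁, front₂₀]
    monoidal
  · simp only [front₁₂, front₂₀, tensorμ, swap, MonoidalCategory.tensorHom_def]
    monoidal

lemma StrictQuasiDual.front_harp_ev (D : StrictQuasiDual ev) (Z : C) :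
    front₂₁ D.harp (H ⊗ Z) ≫ front₂₀ ev Z =
      swap H N (H ⊗ Z) ≫ N ◁ swap H H Z ≫ N ◁ front₂₁ μ[H] Z ≫ front₂₀ ev Z := by
  have h := congrArg (· ▷ Z) D.harp_ev
  simp only [comp_whiskerRight] at h
  rw [← cancel_epi (α_ H N (H ⊗ Z)).hom, ← cancel_epi (α_ (H ⊗ N) H Z).hom,
    ← cancel_mono (λ_ Z).inv]
  refine Eq.trans ?_ (h.trans ?_)
  · simp only [front₂₁, front₂₀]
    monoidal
  · simp only [front₂₁, front₂₀, swap]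
    monoidal

/-- With `H` written first, `⟨h ⇀ n, g⟩ = ⟨n, g h⟩` needs no crossing: by Yang–Baxter the `C_{H,H}`
in the axiom meets the one created by the reordering, and they cancel. -/
lemma StrictQuasiDual.harp_pairing (D : StrictQuasiDual ev)
    (hH : (β_ H H).hom = (β_ H H).inv) (Z : C) :
    H ◁ front₂₁ D.harp Z ≫ pairing ev Z = front₂₁ μ[H] (N ⊗ Z) ≫ pairing ev Z := by
  have hHH : (β_ H H).hom ≫ (β_ H H).hom = 𝟙 _ := by nth_rw 2 [hH]; simp
  have h := congrArg (N ◁ ·) (swap_comp_swap hHH Z)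
  simp only [MonoidalCategory.whiskerLeft_comp] at h
  rw [pairing, reassoc_of% front₂₁_swap_right, D.front_harp_ev, ← reassoc_of% swap_swap_swap,
    reassoc_of% h,
    reassoc_of% front₂₁_swap_left]
  simp

lemma IsFaithfulQuasiDual.mul_pairing (hev : IsFaithfulQuasiDual ev)
    (hH : (β_ H H).hom = (β_ H H).inv) (Z : C) :
    H ◁ front₂₁ μ[N] Z ≫ pairing ev Z = front₁₂ Δ[H] (N ⊗ N ⊗ Z) ≫ H ◁ swap H N (N ⊗ Z) ≫
      pairing ev (H ⊗ N ⊗ Z) ≫ pairing ev Z := by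
  have h₁ := congrArg (N ◁ ·) (swap_comp_swap (hev.braiding_braiding hH) (H ⊗ Z))
  have h₂ := congrArg (N ◁ ·) (front₁₂_swap_left Δ[H] N Z)
  simp only [MonoidalCategory.whiskerLeft_comp] at h₁ h₂
  rw [pairing, reassoc_of% front₂₁_swap_right, hev.front_mul_ev, ← reassoc_of% h₂, reassoc_of% h₁,
    ← reassoc_of% front₁₂_swap_left, MonoidalCategory.whiskerLeft_id, Category.id_comp,
    reassoc_of% front₂₀_naturality, pairing]
  simp

/-- `(g h) ⇀ n = g ⇀ (h ⇀ n)` -/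
lemma StrictQuasiDual.front_harp_harp (D : StrictQuasiDual ev) (hev : IsFaithfulQuasiDual ev)
    (hH : (β_ H H).hom = (β_ H H).inv) (Z : C) :
    H ◁ front₂₁ D.harp Z ≫ front₂₁ D.harp Z =
      front₂₁ μ[H] (N ⊗ Z) ≫ front₂₁ D.harp Z := by
  apply hev.hom_ext_left
  simp only [MonoidalCategory.whiskerLeft_comp, Category.assoc, D.harp_pairing hH]
  rw [reassoc_of% front₂₁_naturality, D.harp_pairing hH, reassoc_of% front_mul_assoc]

/-- `1 ⇀ n = n` -/
lemma StrictQuasiDual.front_one_harp (D : StrictQuasiDual ev) (hev : IsFaithfulQuasiDual ev)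
    (hH : (β_ H H).hom = (β_ H H).inv) (Z : C) :
    front₀₁ η[H] (N ⊗ Z) ≫ front₂₁ D.harp Z = 𝟙 _ := by
  apply hev.hom_ext_left
  simp only [MonoidalCategory.whiskerLeft_comp, Category.assoc, D.harp_pairing hH]
  rw [← Category.assoc, front_mul_one]
  simp

/-- `h ⇀ (m n) = (h₁ ⇀ m) (h₂ ⇀ n)` -/
lemma StrictQuasiDual.front_mul_harp (D : StrictQuasiDual ev) (hev : IsFaithfulQuasiDual ev)
    (hH : (β_ H H).hom = (β_ H H).inv) (Z : C) :
    H ◁ front₂₁ μ[N] Z ≫ front₂₁ D.harp Z = front₁₂ Δ[H] (N ⊗ N ⊗ Z) ≫ H ◁ swap H N (N ⊗ Z) ≫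
      front₂₁ D.harp (H ⊗ N ⊗ Z) ≫ N ◁ front₂₁ D.harp Z ≫ front₂₁ μ[N] Z := by
  apply hev.hom_ext_left
  have h₁ := congrArg (H ◁ ·) (swap_naturality H N (front₂₁ D.harp Z))
  have h₂ := congrArg (H ◁ ·) (front₂₁_swap_right H D.harp (H ⊗ N ⊗ Z))
  have h₃ := congrArg (H ◁ ·) (front₂₁_swap_left μ[H] N (N ⊗ Z))
  have h₄ := congrArg (H ◁ ·) (swap_naturality H H (swap H N (N ⊗ Z)))
  simp only [MonoidalCategory.whiskerLeft_comp] at h₁ h₂ h₃ h₄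
  simp only [MonoidalCategory.whiskerLeft_comp, Category.assoc, D.harp_pairing hH,
    hev.mul_pairing hH]
  rw [reassoc_of% front₂₁_naturality, hev.mul_pairing hH, reassoc_of% front_mul_comul,
    reassoc_of% h₃,
    reassoc_of% pairing_naturality]
  simp only [reassoc_of% front₁₂_naturality]
  rw [reassoc_of% h₁, reassoc_of% h₂, reassoc_of% pairing_naturality, D.harp_pairing hH,
    reassoc_of% D.harp_pairing hH, reassoc_of% h₄, reassoc_of% front₂₁_naturality,
    reassoc_of% front₂₁_naturality]

/-- `m (S(h) ⇀ n) = S(h₁) ⇀ ((h₂ ⇀ m) n)` -/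
lemma StrictQuasiDual.front_mul_antipode_harp (D : StrictQuasiDual ev)
    (hev : IsFaithfulQuasiDual ev) (hH : (β_ H H).hom = (β_ H H).inv) (Z : C) :
    swap H N (N ⊗ Z) ≫ N ◁ 𝒮[H] ▷ (N ⊗ Z) ≫ N ◁ front₂₁ D.harp Z ≫ front₂₁ μ[N] Z =
      front₁₂ Δ[H] (N ⊗ N ⊗ Z) ≫ 𝒮[H] ▷ (H ⊗ N ⊗ N ⊗ Z) ≫ H ◁ front₂₁ D.harp (N ⊗ Z) ≫
        H ◁ front₂₁ μ[N] Z ≫ front₂₁ D.harp Z := by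
  have hf : ∀ W, front₂₁ (𝒮[H] ▷ H ≫ μ[H]) W = 𝒮[H] ▷ (H ⊗ W) ≫ front₂₁ μ[H] W := fun W => by
    simp [front₂₁]
  have h₁ : H ◁ (𝒮[H] ▷ (H ⊗ N ⊗ N ⊗ Z) ≫ H ◁ front₂₁ D.harp (N ⊗ Z) ≫ swap H N (N ⊗ Z)) =
      H ◁ (swap H H (N ⊗ N ⊗ Z) ≫ H ◁ swap H N (N ⊗ Z) ≫ front₂₁ D.harp (H ⊗ N ⊗ Z) ≫
        N ◁ 𝒮[H] ▷ (N ⊗ Z)) := by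
    rw [← whisker_exchange_assoc, swap_naturality_left, reassoc_of% front₂₁_swap_right]
  have h₂ := congrArg (H ◁ ·) (front_antipode_left H (N ⊗ N ⊗ Z))
  have h₃ := front₂₁_swap_right H (𝒮[H] ▷ H ≫ μ[H]) (N ⊗ N ⊗ Z)
  simp only [MonoidalCategory.whiskerLeft_comp, hf, Category.assoc] at h₁ h₂ h₃
  -- From the right-hand side: `S(h₁) ⇀ ((h₂ ⇀ m) n) = (S(h₂) h₃ ⇀ m)(S(h₁) ⇀ n)`, since `S`
  -- reverses `Δ`; then `S(h₂) h₃` collapses to a counit.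
  symm
  rw [D.front_mul_harp hev hH, reassoc_of% front₁₂_naturality, reassoc_of% front_antipode_comul,
    reassoc_of% h₁, reassoc_of% front₂₁_naturality, ← whisker_exchange_assoc,
    ← whisker_exchange_assoc,
    reassoc_of% D.front_harp_harp hev hH, whisker_exchange_assoc, reassoc_of% front₂₁_naturality,
    ← reassoc_of% h₃, reassoc_of% front_comul_assoc, reassoc_of% h₂, reassoc_of% front_comul_counit,
    reassoc_of% front₀₁_swap_right, ← reassoc_of% front₀₁_naturality,
    reassoc_of% D.front_one_harp hev hH]

end Pairing

/-! ### Recognising Hopf modules, and turning left-handed structure into right-handed. -/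

section HopfModuleStructure

variable {C : Type u} [Category.{v} C] [MonoidalCategory C] [BraidedCategory C]

/-- The axioms of a Hopf module may be checked next to an inert tensor factor. -/
lemma IsHopfModule.of_front {H X : C} [HopfObj H] {act : X ⊗ H ⟶ X} {coact : X ⟶ X ⊗ H}
    (act_one : ∀ Z, X ◁ front₀₁ η[H] Z ≫ front₂₁ act Z = 𝟙 _)
    (act_mul : ∀ Z, X ◁ front₂₁ μ[H] Z ≫ front₂₁ act Z = front₂₁ act (H ⊗ Z) ≫ front₂₁ act Z)
    (coact_counit : ∀ Z, front₁₂ coact Z ≫ X ◁ front₁₀ ε[H] Z = 𝟙 _)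
    (coact_comul : ∀ Z,
      front₁₂ coact Z ≫ X ◁ front₁₂ Δ[H] Z = front₁₂ coact Z ≫ front₁₂ coact (H ⊗ Z))
    (act_coact : ∀ Z, front₂₁ act Z ≫ front₁₂ coact Z =
      front₁₂ coact (H ⊗ Z) ≫ X ◁ H ◁ front₁₂ Δ[H] Z ≫
        X ◁ swap H H (H ⊗ Z) ≫ front₂₁ act (H ⊗ H ⊗ Z) ≫ X ◁ front₂₁ μ[H] Z) :
    IsHopfModule H act coact where
  act_one := by
    apply eq_of_whiskerRight_unit
    have h := act_one (𝟙_ C)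
    rw [← cancel_epi ((ρ_ X).hom ▷ 𝟙_ C)] at h
    refine Eq.trans ?_ (h.trans ?_)
    · simp only [front₀₁, front₂₁]
      monoidal
    · simp
  act_mul := by
    apply eq_of_whiskerRight_unit
    have h := act_mul (𝟙_ C)
    rw [← cancel_epi (X ◁ (α_ H H (𝟙_ C)).hom), ← cancel_epi (α_ X (H ⊗ H) (𝟙_ C)).hom] at h
    refine Eq.trans ?_ (h.trans ?_)
    · simp only [front₂₁]
      monoidal
    · simp only [front₂₁]
      monoidal
  coact_counit := by
    apply eq_of_whiskerRight_unit
    have h := coact_counit (𝟙_ C)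
    rw [← cancel_mono ((ρ_ X).inv ▷ 𝟙_ C)] at h
    refine Eq.trans ?_ (h.trans ?_)
    · simp only [front₁₀, front₁₂]
      monoidal
    · simp
  coact_comul := by
    apply eq_of_whiskerRight_unit
    have h := coact_comul (𝟙_ C)
    rw [← cancel_mono (X ◁ (α_ H H (𝟙_ C)).inv), ← cancel_mono (α_ X (H ⊗ H) (𝟙_ C)).inv] at h
    refine Eq.trans ?_ (h.trans ?_)
    · simp only [front₁₂]
      monoidal
    · simp only [front₁₂]
      monoidal
  act_coact := by
    apply eq_of_whiskerRight_unit
    have h := act_coact (𝟙_ C)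
    rw [← cancel_epi (α_ X H (𝟙_ C)).hom, ← cancel_mono (α_ X H (𝟙_ C)).inv] at h
    refine Eq.trans ?_ (h.trans ?_)
    · simp [front₁₂, front₂₁]
    · simp only [front₁₂, front₂₁, tensorμ, swap, MonoidalCategory.tensorHom_def]
      monoidal

variable {H L : C} [HopfObj H]

/-- A left action `a` of the opposite algebra of `H` and a left coaction `σ` of the opposite
coalgebra of `H` on `L` give a right Hopf module when the braiding moves them to the right. -/
lemma isHopfModule_of_left (hHH : (β_ H H).hom ≫ (β_ H H).hom = 𝟙 _)
    (hHL : (β_ H L).hom ≫ (β_ L H).hom = 𝟙 _) {a : H ⊗ L ⟶ L} {σ : L ⟶ H ⊗ L}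
    (one_a : front₀₁ η[H] L ≫ a = 𝟙 _)
    (mul_a : front₂₁ μ[H] L ≫ a = swap H H L ≫ H ◁ a ≫ a)
    (σ_counit : σ ≫ front₁₀ ε[H] L = 𝟙 _)
    (σ_comul : σ ≫ front₁₂ Δ[H] L = σ ≫ H ◁ σ ≫ swap H H L)
    (a_σ : a ≫ σ = front₁₂ Δ[H] L ≫ H ◁ H ◁ σ ≫ H ◁ swap H H L ≫ H ◁ front₂₁ μ[H] L ≫
      swap H H L ≫ H ◁ a) :
    IsHopfModule H ((β_ L H).hom ≫ a) (σ ≫ (β_ H L).hom) := by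
  have front_act : ∀ Z, front₂₁ ((β_ L H).hom ≫ a) Z = swap L H Z ≫ front₂₁ a Z := fun Z => by
    simp [front₂₁, swap]
  have swap_front_act : ∀ Z, swap H L Z ≫ front₂₁ ((β_ L H).hom ≫ a) Z = front₂₁ a Z := fun Z => by
    rw [front_act, reassoc_of% swap_comp_swap hHL]
  have front_coact : ∀ Z, front₁₂ (σ ≫ (β_ H L).hom) Z = front₁₂ σ Z ≫ swap H L Z := fun Z => by
    simp [front₁₂, swap]
  have one_a' : ∀ Z, front₀₁ η[H] (L ⊗ Z) ≫ front₂₁ a Z = 𝟙 _ := fun Z => by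
    have h := congrArg (· ▷ Z) one_a
    simp only [front₀₁, comp_whiskerRight, Category.assoc] at h
    refine Eq.trans ?_ (h.trans ?_)
    · simp only [front₀₁, front₂₁]
      monoidal
    · simp
  have mul_a' : ∀ Z, front₂₁ μ[H] (L ⊗ Z) ≫ front₂₁ a Z =
      swap H H (L ⊗ Z) ≫ H ◁ front₂₁ a Z ≫ front₂₁ a Z := fun Z => by
    have h := congrArg (· ▷ Z) mul_a
    simp only [front₂₁, swap, comp_whiskerRight, Category.assoc] at h
    rw [← cancel_epi (H ◁ (α_ H L Z).hom), ← cancel_epi (α_ H (H ⊗ L) Z).hom]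
    refine Eq.trans ?_ (h.trans ?_) <;>
    · simp only [front₂₁, swap]
      monoidal
  have σ_counit' : ∀ Z, front₁₂ σ Z ≫ front₁₀ ε[H] (L ⊗ Z) = 𝟙 _ := fun Z => by
    have h := congrArg (· ▷ Z) σ_counit
    simp only [front₁₀, comp_whiskerRight] at h
    refine Eq.trans ?_ (h.trans ?_)
    · simp only [front₁₀, front₁₂]
      monoidal
    · simp
  have σ_comul' : ∀ Z, front₁₂ σ Z ≫ front₁₂ Δ[H] (L ⊗ Z) =
      front₁₂ σ Z ≫ H ◁ front₁₂ σ Z ≫ swap H H (L ⊗ Z) := fun Z => by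
    have h := congrArg (· ▷ Z) σ_comul
    simp only [front₁₂, swap, comp_whiskerRight] at h
    rw [← cancel_mono (H ◁ (α_ H L Z).inv), ← cancel_mono (α_ H (H ⊗ L) Z).inv]
    refine Eq.trans ?_ (h.trans ?_) <;>
    · simp only [front₁₂, swap]
      monoidal
  have a_σ' : ∀ Z, front₂₁ a Z ≫ front₁₂ σ Z = front₁₂ Δ[H] (L ⊗ Z) ≫ H ◁ H ◁ front₁₂ σ Z ≫
      H ◁ swap H H (L ⊗ Z) ≫ H ◁ front₂₁ μ[H] (L ⊗ Z) ≫ swap H H (L ⊗ Z) ≫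
        H ◁ front₂₁ a Z := fun Z => by
    have h := congrArg (· ▷ Z) a_σ
    simp only [front₁₂, front₂₁, swap, comp_whiskerRight, Category.assoc] at h
    rw [← cancel_epi (α_ H L Z).hom, ← cancel_mono (α_ H L Z).inv]
    refine Eq.trans ?_ (h.trans ?_) <;>
    · simp only [front₁₂, front₂₁, swap]
      monoidal
  apply IsHopfModule.of_front
  · intro Z
    rw [front_act, reassoc_of% front₀₁_swap_right, one_a']
  · intro Z
    rw [front_act, front_act, reassoc_of% front₂₁_swap_right, mul_a', Category.assoc,
      reassoc_of% front₂₁_swap_left]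
  · intro Z
    rw [front_coact, Category.assoc, front₁₀_swap_left, σ_counit']
  · intro Z
    have h := front₁₂_swap_right H (σ ≫ (β_ H L).hom) Z
    rw [front_coact Z, Category.assoc, Category.assoc, ← h, ← front₁₂_swap_left,
      reassoc_of% σ_comul' Z, front_coact Z, MonoidalCategory.whiskerLeft_comp, Category.assoc,
      swap_swap_swap]
  · intro Z
    have h₁ := congrArg (H ◁ ·) (front₂₁_swap_left μ[H] L Z)
    have h₂ := congrArg (L ◁ ·) (front₁₂_swap_left Δ[H] H Z)
    have h₃ := congrArg (L ◁ ·) (swap_comp_swap hHH (H ⊗ Z))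
    have h₄ := congrArg (H ◁ ·) (swap_swap_swap H H L Z)
    simp only [MonoidalCategory.whiskerLeft_comp] at h₁ h₂ h₃ h₄
    -- Precomposing with an invertible crossing undoes the braiding in the right action and exposes
    -- `a`, so that `a_σ'` applies.
    rw [← cancel_epi (swap H L Z), reassoc_of% swap_front_act Z,
      ← reassoc_of% front₁₂_swap_right, ← reassoc_of% h₂, reassoc_of% h₃,
      MonoidalCategory.whiskerLeft_id, Category.id_comp, ← reassoc_of% front₁₂_swap_left,
      ← reassoc_of% swap_naturality, reassoc_of% swap_front_act (H ⊗ H ⊗ Z),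
      ← front₂₁_naturality, front_coact Z, reassoc_of% a_σ' Z, front₂₁_swap_right,
      reassoc_of% swap_comp_swap hHH, reassoc_of% h₁, ← reassoc_of% h₄]
    simp only [MonoidalCategory.whiskerLeft_comp, Category.assoc, reassoc_of% front₁₂_naturality]

end HopfModuleStructure

/-! ### The strict quasi-dual as a Hopf module. -/

section StrictQuasiDual

variable {C : Type u} [Category.{v} C] [MonoidalCategory C] {N : C} [MonObj N]

namespace LeftIdeal

variable (L : LeftIdeal N)

lemma one_mul : front₀₁ η[N] L.X ≫ L.mul = 𝟙 _ := by
  have := L.mono_incl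
  rw [← cancel_mono L.incl, Category.assoc, L.mul_incl, ← reassoc_of% front₀₁_naturality]
  simp [front₀₁]

lemma mul_mul : front₂₁ μ[N] L.X ≫ L.mul = N ◁ L.mul ≫ L.mul := by
  have := L.mono_incl
  rw [← cancel_mono L.incl, Category.assoc, L.mul_incl, ← reassoc_of% front₂₁_naturality,
    Category.assoc, L.mul_incl, ← MonoidalCategory.whiskerLeft_comp_assoc, L.mul_incl]
  simp [front₂₁]

/-- The triviality for `N` restricts along `incl`. Since `H ◁ incl` is not known to be mono, the `H`
factor is paired away before `incl` is cancelled. -/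
lemma braiding_braiding [BraidedCategory C] {H : C} [HopfObj H] {ev : N ⊗ H ⟶ 𝟙_ C}
    (hev : IsFaithfulQuasiDual ev) (hH : (β_ H H).hom = (β_ H H).inv) :
    (β_ H L.X).hom ≫ (β_ L.X H).hom = 𝟙 _ := by
  have := L.mono_incl
  rw [← Iso.eq_inv_comp, Category.comp_id]
  apply hev.hom_ext_right
  rw [← cancel_mono L.incl]
  simp only [Category.assoc, ← front₂₀_naturality, ← MonoidalCategory.whiskerLeft_comp_assoc]
  congr 2
  rw [← BraidedCategory.braiding_naturality_left, ← BraidedCategory.braiding_inv_naturality_left]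
  congr 1
  rw [← Category.comp_id (β_ H N).inv, Iso.eq_inv_comp, hev.braiding_braiding hH]

end LeftIdeal

variable [BraidedCategory C] {H : C} [HopfObj H] {ev : N ⊗ H ⟶ 𝟙_ C}

namespace StrictQuasiDual

variable (D : StrictQuasiDual ev)

/-- The coaction of a strict quasi-dual, moved to the left by the braiding. -/
def leftCoact : D.L.X ⟶ H ⊗ D.L.X := D.coact ≫ (β_ H D.L.X).inv

/-- `h ⊗ f ↦ S(h) ⇀ f` -/
def leftAct : H ⊗ D.L.X ⟶ D.L.X := 𝒮[H] ▷ D.L.X ≫ D.harpL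

/-- The bridge between coaction and ideal: by faithfulness, this determines the left coaction from
the action of `N` on `L`. -/
lemma leftCoact_ev : N ◁ D.leftCoact ≫ front₂₀ ev D.L.X = D.L.mul := by
  rw [← D.coact_ev, leftCoact, front₂₀_eq_braiding]
  simp

lemma leftCoact_counit (hev : IsFaithfulQuasiDual ev) :
    D.leftCoact ≫ front₁₀ ε[H] D.L.X = 𝟙 _ := by
  have h : front₀₁ η[N] (H ⊗ D.L.X) ≫ front₂₀ ev D.L.X = front₁₀ ε[H] D.L.X := by
    have h := congrArg (· ▷ D.L.X) hev.one_ev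
    simp only [comp_whiskerRight] at h
    simp only [front₀₁, front₂₀, front₁₀, Category.assoc]
    rw [associator_inv_naturality_left_assoc, reassoc_of% h]
    monoidal
  rw [← h, reassoc_of% front₀₁_naturality, D.leftCoact_ev, D.L.one_mul]

/-- Tested against two factors of `N`, coassociativity becomes `(m n) f = m (n f)`, because the
product of `N` is dual to `Δ`. -/
lemma leftCoact_comul (hev : IsFaithfulQuasiDual ev) (hH : (β_ H H).hom = (β_ H H).inv) :
    D.leftCoact ≫ front₁₂ Δ[H] D.L.X = D.leftCoact ≫ H ◁ D.leftCoact ≫ swap H H D.L.X := by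
  have hHH : (β_ H H).hom ≫ (β_ H H).hom = 𝟙 _ := by nth_rw 2 [hH]; simp
  have hNH : (β_ N H).hom ≫ (β_ H N).hom = 𝟙 _ := by
    rw [← cancel_epi (β_ H N).hom, reassoc_of% hev.braiding_braiding hH, Category.comp_id]
  have key : N ◁ (D.leftCoact ≫ front₁₂ Δ[H] D.L.X) ≫ swap N H (H ⊗ D.L.X) ≫
      H ◁ front₂₀ ev D.L.X = N ◁ (D.leftCoact ≫ H ◁ D.leftCoact) ≫ front₂₀ ev (H ⊗ D.L.X) := by
    apply hev.hom_ext_right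
    have h := D.L.mul_mul
    rw [← D.leftCoact_ev, ← reassoc_of% front₂₁_naturality, hev.front_mul_ev] at h
    simp only [MonoidalCategory.whiskerLeft_comp, Category.assoc, front₂₀_naturality] at h ⊢
    exact h
  have h₁ : N ◁ (D.leftCoact ≫ front₁₂ Δ[H] D.L.X ≫ swap H H D.L.X) ≫
      front₂₀ ev (H ⊗ D.L.X) = N ◁ (D.leftCoact ≫ H ◁ D.leftCoact) ≫ front₂₀ ev (H ⊗ D.L.X) := by
    rw [← key, ← front₂₀_swap_right, reassoc_of% swap_comp_swap hNH]
    simp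
  have h₂ := hev.hom_ext_right h₁
  rw [← reassoc_of% h₂, swap_comp_swap hHH, Category.comp_id]

lemma one_leftAct (hev : IsFaithfulQuasiDual ev) (hH : (β_ H H).hom = (β_ H H).inv) :
    front₀₁ η[H] D.L.X ≫ D.leftAct = 𝟙 _ := by
  have := D.L.mono_incl
  have h : front₀₁ η[H] N ≫ D.harp = 𝟙 _ := by
    apply eq_of_whiskerRight_unit
    refine Eq.trans ?_ ((D.front_one_harp hev hH (𝟙_ C)).trans ?_)
    · simp only [front₀₁, front₂₁]
      monoidal
    · simp
  have h' : front₀₁ η[H] D.L.X ≫ 𝒮[H] ▷ D.L.X = front₀₁ η[H] D.L.X := by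
    rw [front₀₁, Category.assoc, ← comp_whiskerRight, HopfObj.one_antipode]
  rw [← cancel_mono D.L.incl, leftAct, reassoc_of% h', Category.assoc, D.harpL_incl,
    ← reassoc_of% front₀₁_naturality, h]
  simp

/-- The antipode is antimultiplicative, so it turns the left action `⇀` into an action of the
opposite algebra. -/
lemma mul_leftAct (hev : IsFaithfulQuasiDual ev) (hH : (β_ H H).hom = (β_ H H).inv) :
    front₂₁ μ[H] D.L.X ≫ D.leftAct = swap H H D.L.X ≫ H ◁ D.leftAct ≫ D.leftAct := by
  have := D.L.mono_incl
  have h : H ◁ D.harp ≫ D.harp = front₂₁ μ[H] N ≫ D.harp := by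
    apply eq_of_whiskerRight_unit
    rw [← cancel_epi (α_ H (H ⊗ N) (𝟙_ C)).inv, ← cancel_epi (H ◁ (α_ H N (𝟙_ C)).inv)]
    refine Eq.trans ?_ ((D.front_harp_harp hev hH (𝟙_ C)).trans ?_) <;>
    · simp only [front₂₁]
      monoidal
  have h' : H ◁ D.harpL ≫ D.harpL = front₂₁ μ[H] D.L.X ≫ D.harpL := by
    rw [← cancel_mono D.L.incl]
    simp only [Category.assoc, D.harpL_incl]
    rw [← MonoidalCategory.whiskerLeft_comp_assoc, D.harpL_incl, ← reassoc_of% front₂₁_naturality,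
      ← h]
    simp
  simp only [leftAct, MonoidalCategory.whiskerLeft_comp, Category.assoc]
  rw [whisker_exchange_assoc, h', reassoc_of% front_mul_antipode,
    reassoc_of% swap_naturality_middle,
    reassoc_of% swap_naturality_left]

/-- `n (S(h) ⇀ f) = S(h₁) ⇀ ((h₂ ⇀ n) f)` -/
lemma mul_leftAct_left (hev : IsFaithfulQuasiDual ev) (hH : (β_ H H).hom = (β_ H H).inv) :
    swap H N D.L.X ≫ N ◁ D.leftAct ≫ D.L.mul =
      front₁₂ Δ[H] (N ⊗ D.L.X) ≫ H ◁ front₂₁ D.harp D.L.X ≫ H ◁ D.L.mul ≫ D.leftAct := by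
  have := D.L.mono_incl
  have h : swap H N N ≫ N ◁ 𝒮[H] ▷ N ≫ N ◁ D.harp ≫ μ[N] =
      front₁₂ Δ[H] (N ⊗ N) ≫ 𝒮[H] ▷ (H ⊗ N ⊗ N) ≫ H ◁ front₂₁ D.harp N ≫ H ◁ μ[N] ≫
        D.harp := by
    apply eq_of_whiskerRight_unit
    rw [← cancel_epi (α_ H (N ⊗ N) (𝟙_ C)).inv, ← cancel_epi (H ◁ (α_ N N (𝟙_ C)).inv)]
    refine Eq.trans ?_ ((D.front_mul_antipode_harp hev hH (𝟙_ C)).trans ?_) <;>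
    · simp only [front₁₂, front₂₁, swap]
      monoidal
  rw [← cancel_mono D.L.incl]
  have h₁ := congrArg (N ◁ ·) D.harpL_incl
  have h₂ := congrArg (H ◁ ·) D.L.mul_incl
  have h₃ := congrArg (N ◁ ·) (whisker_exchange 𝒮[H] D.L.incl)
  have h₄ := congrArg (H ◁ ·) (front₂₁_naturality D.harp D.L.incl)
  simp only [MonoidalCategory.whiskerLeft_comp] at h₁ h₂ h₃ h₄
  simp only [leftAct, MonoidalCategory.whiskerLeft_comp, Category.assoc, D.harpL_incl,
    D.L.mul_incl]
  rw [reassoc_of% h₁, ← reassoc_of% h₃, ← reassoc_of% swap_naturality, h]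
  simp only [← whisker_exchange_assoc]
  rw [reassoc_of% h₂, ← reassoc_of% h₄, reassoc_of% front₁₂_naturality]

/-- `(S(h) ⇀ f)₁ ⊗ (S(h) ⇀ f)₀ = f₁ h₂ ⊗ (S(h₁) ⇀ f₀)` -/
lemma leftAct_leftCoact (hev : IsFaithfulQuasiDual ev) (hH : (β_ H H).hom = (β_ H H).inv) :
    D.leftAct ≫ D.leftCoact = front₁₂ Δ[H] D.L.X ≫ H ◁ H ◁ D.leftCoact ≫
      H ◁ swap H H D.L.X ≫ H ◁ front₂₁ μ[H] D.L.X ≫ swap H H D.L.X ≫ H ◁ D.leftAct := by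
  -- Tested against `n`, the left side is `n (S(h) ⇀ f) = S(h₁) ⇀ ((h₂ ⇀ n) f)`. Expanding the inner
  -- product through the coaction gives `⟨h₂ ⇀ n, f₁⟩ f₀ = ⟨n, f₁ h₂⟩ f₀`, which is the right side.
  apply hev.hom_ext_right
  have h₁ := congrArg (H ◁ ·) (front₂₁_naturality D.harp D.leftCoact)
  have h₂ := congrArg (H ◁ ·) (D.front_harp_ev D.L.X)
  have h₃ := congrArg (H ◁ ·) D.leftCoact_ev
  have h₄ := congrArg (H ◁ ·) (swap_naturality H N D.leftCoact)
  simp only [MonoidalCategory.whiskerLeft_comp] at h₁ h₂ h₃ h₄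
  rw [← cancel_epi (swap H N D.L.X)]
  simp only [MonoidalCategory.whiskerLeft_comp, Category.assoc]
  rw [D.leftCoact_ev, D.mul_leftAct_left hev hH, ← h₃, Category.assoc, ← reassoc_of% h₁,
    reassoc_of% h₂, reassoc_of% h₄, front₂₀_naturality, ← reassoc_of% front₁₂_swap_left,
    ← reassoc_of% swap_naturality, ← reassoc_of% swap_naturality, ← reassoc_of% swap_naturality,
    reassoc_of% front₂₀_swap_right]

theorem isHopfModule (hev : IsFaithfulQuasiDual ev) (hH : (β_ H H).hom = (β_ H H).inv) :
    IsHopfModule H D.act D.coact := by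
  have hHH : (β_ H H).hom ≫ (β_ H H).hom = 𝟙 _ := by nth_rw 2 [hH]; simp
  have h := isHopfModule_of_left hHH (D.L.braiding_braiding hev hH) (D.one_leftAct hev hH)
    (D.mul_leftAct hev hH) (D.leftCoact_counit hev) (D.leftCoact_comul hev hH)
    (D.leftAct_leftCoact hev hH)
  simpa [leftCoact, leftAct, act] using h

end StrictQuasiDual

end StrictQuasiDual

end BraidedHopf

theorem theorem1p5 {C : Type u} [Category.{v} C] [MonoidalCategory C] [BraidedCategory C]
    (H : C) [HopfObj H] (hH : (β_ H H).hom = (β_ H H).inv)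
    (N : C) [MonObj N] (ev : N ⊗ H ⟶ 𝟙_ C) (hev : BraidedHopf.IsFaithfulQuasiDual ev)
    (D : BraidedHopf.StrictQuasiDual ev)
    (hC : HasEqualizers C ∨ BraidedHopf.HasCoinvariants D.coact) :
    ∃ (hD : BraidedHopf.IsHopfModule H D.act D.coact)
      (_ : BraidedHopf.HasCoinvariants D.coact),
      Nonempty ((⟨D.L.X, D.act, D.coact, hD⟩ : BraidedHopf.HopfModule H) ≅
        BraidedHopf.HopfModule.free H (BraidedHopf.coinvariants D.coact)) := by
  have hcoinv : BraidedHopf.HasCoinvariants D.coact := hC.elim (fun _ => inferInstance) id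
  exact ⟨D.isHopfModule hev hH, hcoinv, (D.isHopfModule hev hH).nonempty_iso_free⟩
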